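/- An EMV-algebra is an algebra $(M;\vee,\wedge,\oplus,0)$ such that (i) $(M;\vee,\wedge,0)$ is a distributive lattice with bottom element $0$; (ii) $(M;\oplus,0)$ is a commutative ordered monoid with neutral element $0$ (that is, $x\le y$ implies $x\oplus z\le y\oplus z$); (iii) for each idempotent $a$ (i.e. $a\oplus a=a$), the element $\lambda_a(x):=\min\{z\in[0,a]\mid z\oplus x=a\}$ exists for all $x\in[0,a]$ and $([0,a];\oplus,\lambda_a,0,a)$ is an MV-algebra; (iv) for each $x\in M$ there is an idempotent $a$ with $x\le a$. The real interval $[0,1]$ is an EMV-algebra with its usual order and $x\oplus y=\min\{x+y,1\}$. A state-morphism on $M$ is a map $s:M\to[0,1]$ which preserves $\vee,\wedge,\oplus,0$, satisfies $s(\lambda_b(x))=\lambda_{s(b)}(s(x))$ for every idempotent $b\in M$ and every $x\in[0,b]$, and has $s(x)=1$ for some $x\in M$. The set $\mathcal{SM}(M)$ of state-morphisms carries the weak topology, i.e. the subspace topology of the product space $[0,1]^M$. An ideal of $M$ is a non-empty down-closed subset of $M$ closed under $\oplus$; a maximal ideal is a proper ideal not properly contained in another proper ideal. The set $\mathrm{MaxI}(M)$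 of maximal ideals carries the hull-kernel topology, whose open sets are the sets $O(I)=\{A\in\mathrm{MaxI}(M)\mid A\not\supseteq I\}$, $I$ an ideal of $M$. **Theorem.** Let $M$ be an EMV-algebra. The mapping $\theta:\mathcal{SM}(M)\to\mathrm{MaxI}(M)$, $\theta(s)=\mathrm{Ker}(s):=\{x\in M\mid s(x)=0\}$, is (well defined and) a homeomorphism. In addition, the following statements are equivalent: (i) $M$ has a top element; (ii) $\mathcal{SM}(M)$ is compact in the weak topology; (iii) $\mathrm{MaxI}(M)$ is compact in the hull-kernel topology. -/

import Mathlib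

universe u v

/-- `(A; op, neg, zero, one)` is an MV-algebra, where the universe `A` is a subset of an ambient
type: `A` is closed under the operations, and the MV-axioms hold for all elements of `A`. -/
structure IsMVAlgebraOn {M : Type u} (A : Set M) (op : M → M → M) (neg : M → M)
    (zero one : M) : Prop where
  zero_mem : zero ∈ A
  one_mem : one ∈ A
  op_mem : ∀ x ∈ A, ∀ y ∈ A, op x y ∈ A
  neg_mem : ∀ x ∈ A, neg x ∈ A
  op_assoc : ∀ x ∈ A, ∀ y ∈ A, ∀ z ∈ A, op (op x y) z = op x (op y z)
  op_comm : ∀ x ∈ A, ∀ y ∈ A, op x y = op y x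
  op_zero : ∀ x ∈ A, op x zero = x
  neg_neg : ∀ x ∈ A, neg (neg x) = x
  op_one : ∀ x ∈ A, op x one = one
  lukasiewicz : ∀ x ∈ A, ∀ y ∈ A,
    op x (neg (op x (neg y))) = op y (neg (op y (neg x)))

/-- An EMV-algebra `(M; ⊔, ⊓, ⊕, ⊥)`: a distributive lattice with bottom element `⊥` and a
commutative ordered monoid `(M; ⊕, ⊥)` such that, for each idempotent `a`, every `x ∈ [⊥, a]` has
a least `z ∈ [⊥, a]` with `z ⊕ x = a`, called `λ_a(x)`, the interval `([⊥, a]; ⊕, λ_a, ⊥, a)` is an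
MV-algebra, and every element lies below an idempotent. -/
class EMVAlgebra (M : Type u) [DistribLattice M] [OrderBot M] where
  /-- the operation `⊕` -/
  oplus : M → M → M
  oplus_assoc : ∀ x y z : M, oplus (oplus x y) z = oplus x (oplus y z)
  oplus_comm : ∀ x y : M, oplus x y = oplus y x
  oplus_bot : ∀ x : M, oplus x ⊥ = x
  oplus_mono : ∀ x y z : M, x ≤ y → oplus x z ≤ oplus y z
  interval : ∀ a : M, oplus a a = a → ∃ lam : M → M,
    (∀ x, x ≤ a → IsLeast {z : M | z ≤ a ∧ oplus z x = a} (lam x)) ∧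
      IsMVAlgebraOn (Set.Iic a) oplus lam ⊥ a
  exists_idempotent : ∀ x : M, ∃ a : M, oplus a a = a ∧ x ≤ a

namespace EMVAlgebra

section Basic

variable {M : Type u} [DistribLattice M] [OrderBot M] [EMVAlgebra M]

local infixl:65 " ⊕ₑ " => EMVAlgebra.oplus

/-- The idempotent elements `a ⊕ a = a`. -/
def IsIdem (a : M) : Prop := a ⊕ₑ a = a

open Classical in
/-- `λ_a(x) = min {z ∈ [⊥, a] | z ⊕ x = a}` for `a` idempotent and `x ≤ a` (only used there). -/
noncomputable def lam (a x : M) : M :=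
  if h : IsIdem a then Classical.choose (interval a h) x else ⊥

theorem isLeast_lam {a x : M} (ha : IsIdem a) (hx : x ≤ a) :
    IsLeast {z : M | z ≤ a ∧ z ⊕ₑ x = a} (lam a x) := by
  have h := (Classical.choose_spec (interval a ha)).1 x hx
  simpa only [lam, dif_pos ha] using h

theorem isMVAlgebraOn_Iic {a : M} (ha : IsIdem a) :
    IsMVAlgebraOn (Set.Iic a) (oplus (M := M)) (lam a) ⊥ a := by
  have h := (Classical.choose_spec (interval a ha)).2
  have e : lam a = Classical.choose (interval a ha) := by
    funext x
    simp only [lam, dif_pos ha]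
  rw [e]
  exact h

/-- Ideals: nonempty lower sets closed under `⊕`. -/
structure IsIdeal (I : Set M) : Prop where
  nonempty : I.Nonempty
  lower : ∀ x y : M, x ≤ y → y ∈ I → x ∈ I
  oplus_mem : ∀ x y : M, x ∈ I → y ∈ I → x ⊕ₑ y ∈ I

/-- Maximal ideals: proper ideals not properly contained in another proper ideal. -/
structure IsMaximalIdeal (I : Set M) : Prop where
  isIdeal : IsIdeal I
  ne_univ : I ≠ Set.univ
  maximal : ∀ J : Set M, IsIdeal J → J ≠ Set.univ → I ⊆ J → J = I

variable (M) in
/-- The set `MaxI(M)` of maximal ideals. -/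
def MaxI : Type u := {I : Set M // IsMaximalIdeal I}

/-- `O(I)`: the maximal ideals that do not contain `I`. -/
def hullCompl (I : Set M) : Set (MaxI M) := {A | ¬ I ⊆ A.1}

theorem IsIdeal.bot_mem {I : Set M} (hI : IsIdeal I) : (⊥ : M) ∈ I :=
  let ⟨x, hx⟩ := hI.nonempty
  hI.lower ⊥ x bot_le hx

theorem isIdeal_univ : IsIdeal (Set.univ : Set M) :=
  ⟨⟨⊥, trivial⟩, fun _ _ _ _ => trivial, fun _ _ _ _ => trivial⟩

theorem isIdeal_sInter {S : Set (Set M)} (h : ∀ I ∈ S, IsIdeal I) : IsIdeal (⋂₀ S) where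
  nonempty := ⟨⊥, fun I hI => (h I hI).bot_mem⟩
  lower x y hxy hy I hI := (h I hI).lower x y hxy (hy I hI)
  oplus_mem x y hx hy I hI := (h I hI).oplus_mem x y (hx I hI) (hy I hI)

theorem isIdeal_inter {I J : Set M} (hI : IsIdeal I) (hJ : IsIdeal J) : IsIdeal (I ∩ J) where
  nonempty := ⟨⊥, hI.bot_mem, hJ.bot_mem⟩
  lower x y hxy hy := ⟨hI.lower x y hxy hy.1, hJ.lower x y hxy hy.2⟩
  oplus_mem x y hx hy := ⟨hI.oplus_mem x y hx.1 hy.1, hJ.oplus_mem x y hx.2 hy.2⟩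

theorem oplus_le_oplus {x y z w : M} (h₁ : x ≤ y) (h₂ : z ≤ w) : x ⊕ₑ z ≤ y ⊕ₑ w := by
  refine (oplus_mono x y z h₁).trans ?_
  rw [oplus_comm y z, oplus_comm y w]
  exact oplus_mono z w y h₂

theorem le_oplus_left (x y : M) : x ≤ x ⊕ₑ y := by
  have h := oplus_le_oplus (le_refl x) (bot_le (a := y))
  rwa [oplus_bot] at h

theorem le_oplus_right (x y : M) : y ≤ x ⊕ₑ y := by
  rw [oplus_comm]
  exact le_oplus_left y x

theorem le_iff_lam {a x y : M} (ha : IsIdem a) (hx : x ≤ a) (hy : y ≤ a) :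
    x ≤ y ↔ lam a x ⊕ₑ y = a := by
  have hMV := isMVAlgebraOn_Iic ha
  have hlx : lam a x ≤ a := hMV.neg_mem x hx
  constructor
  · intro h
    apply le_antisymm (hMV.op_mem _ hlx _ hy)
    calc a = lam a x ⊕ₑ x := (isLeast_lam ha hx).1.2.symm
      _ ≤ _ := oplus_le_oplus le_rfl h
  · intro h
    have h2 := (isLeast_lam ha hlx).2 (show y ∈ _ from ⟨hy, by rw [oplus_comm]; exact h⟩)
    rwa [hMV.neg_neg x hx] at h2

theorem oplus_inf_le (x y z : M) : (x ⊕ₑ y) ⊓ (x ⊕ₑ z) ≤ x ⊕ₑ (y ⊓ z) := by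
  obtain ⟨a, ha, hle⟩ := exists_idempotent ((x ⊕ₑ y) ⊔ (x ⊕ₑ z))
  have hxy : x ⊕ₑ y ≤ a := le_sup_left.trans hle
  have hxz : x ⊕ₑ z ≤ a := le_sup_right.trans hle
  have hx : x ≤ a := (le_oplus_left x y).trans hxy
  have hy : y ≤ a := (le_oplus_right x y).trans hxy
  have hz : z ≤ a := (le_oplus_right x z).trans hxz
  have hMV := isMVAlgebraOn_Iic (a := a) ha
  -- residuation: `t ≤ x ⊕ w ↔ t ⊖ x ≤ w`
  have key : ∀ t w : M, t ≤ a → w ≤ a →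
      (t ≤ x ⊕ₑ w ↔ lam a (lam a t ⊕ₑ x) ≤ w) := by
    intro t w ht hw
    have hlt : lam a t ≤ a := hMV.neg_mem t ht
    have hs : lam a t ⊕ₑ x ≤ a := hMV.op_mem _ hlt _ hx
    rw [le_iff_lam ha ht (hMV.op_mem _ hx _ hw), le_iff_lam ha (hMV.neg_mem _ hs) hw,
      hMV.neg_neg _ hs, oplus_assoc]
  have ht : (x ⊕ₑ y) ⊓ (x ⊕ₑ z) ≤ a := inf_le_left.trans hxy
  rw [key _ _ ht (inf_le_left.trans hy)]
  exact le_inf ((key _ _ ht hy).1 inf_le_left) ((key _ _ ht hz).1 inf_le_right)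

theorem inf_oplus_le (y u v : M) : y ⊓ (u ⊕ₑ v) ≤ (y ⊓ u) ⊕ₑ (y ⊓ v) := by
  refine le_trans ?_ (oplus_inf_le (y ⊓ u) y v)
  refine le_inf (inf_le_left.trans (le_oplus_right _ _)) ?_
  rw [oplus_comm (y ⊓ u) v]
  refine le_trans ?_ (oplus_inf_le v y u)
  refine le_inf (inf_le_left.trans (le_oplus_right _ _)) ?_
  rw [oplus_comm v u]
  exact inf_le_right

/-- Maximal ideals are prime. -/
theorem IsMaximalIdeal.prime {A : Set M} (hA : IsMaximalIdeal A) {x y : M} (h : x ⊓ y ∈ A) :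
    x ∈ A ∨ y ∈ A := by
  by_contra! hn
  obtain ⟨hxA, hyA⟩ := hn
  have hI := hA.isIdeal
  -- the ideal of all `z` whose meet with `y` lies in `A`
  let J : Set M := {z | z ⊓ y ∈ A}
  have hJ : IsIdeal J :=
    { nonempty := ⟨x, h⟩
      lower := fun z w hzw hw => hI.lower _ _ (inf_le_inf_right y hzw) hw
      oplus_mem := fun z w hz hw => by
        change (z ⊕ₑ w) ⊓ y ∈ A
        have hz' : y ⊓ z ∈ A := by rw [inf_comm]; exact hz
        have hw' : y ⊓ w ∈ A := by rw [inf_comm]; exact hw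
        rw [inf_comm]
        exact hI.lower _ _ (inf_oplus_le y z w) (hI.oplus_mem _ _ hz' hw') }
  have hJne : J ≠ Set.univ := by
    intro e
    have hy : y ∈ J := by rw [e]; trivial
    exact hyA (by simpa [J] using hy)
  have hAJ : A ⊆ J := fun z hz => hI.lower _ _ inf_le_left hz
  have e := hA.maximal J hJ hJne hAJ
  have hx : x ∈ J := h
  rw [e] at hx
  exact hxA hx

/-- The hull-kernel topology: the open sets are exactly the sets `O(I)`, `I` an ideal of `M`. -/
instance : TopologicalSpace (MaxI M) where
  IsOpen U := ∃ I : Set M, IsIdeal I ∧ U = hullCompl I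
  isOpen_univ := by
    refine ⟨Set.univ, isIdeal_univ, ?_⟩
    ext A
    simpa [hullCompl, Set.univ_subset_iff] using A.2.ne_univ
  isOpen_inter := by
    rintro _ _ ⟨I, hI, rfl⟩ ⟨J, hJ, rfl⟩
    refine ⟨I ∩ J, isIdeal_inter hI hJ, ?_⟩
    ext A
    constructor
    · rintro ⟨h₁, h₂⟩ h
      obtain ⟨x, hx, hxA⟩ := Set.not_subset.1 h₁
      obtain ⟨y, hy, hyA⟩ := Set.not_subset.1 h₂
      have hxy : x ⊓ y ∈ A.1 :=
        h ⟨hI.lower _ _ inf_le_left hx, hJ.lower _ _ inf_le_right hy⟩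
      exact (A.2.prime hxy).elim hxA hyA
    · intro h
      exact ⟨fun h' => h (Set.inter_subset_left.trans h'),
        fun h' => h (Set.inter_subset_right.trans h')⟩
  isOpen_sUnion := by
    intro S hS
    refine ⟨⋂₀ {K : Set M | IsIdeal K ∧ ∀ I, IsIdeal I → hullCompl I ∈ S → I ⊆ K},
      isIdeal_sInter fun K hK => hK.1, ?_⟩
    ext A
    constructor
    · rintro ⟨U, hU, hAU⟩ h
      obtain ⟨I, hI, rfl⟩ := hS U hU
      exact hAU (Set.Subset.trans (Set.subset_sInter fun K hK => hK.2 I hI hU) h)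
    · intro h
      by_contra hn
      apply h
      refine Set.sInter_subset_of_mem ⟨A.2.isIdeal, fun I _ hIS => ?_⟩
      by_contra hIA
      exact hn ⟨hullCompl I, hIS, hIA⟩

end Basic

/-- EMV-homomorphisms. -/
structure IsEMVHom {M : Type u} {N : Type v} [DistribLattice M] [OrderBot M] [EMVAlgebra M]
    [DistribLattice N] [OrderBot N] [EMVAlgebra N] (f : M → N) : Prop where
  map_sup : ∀ x y : M, f (x ⊔ y) = f x ⊔ f y
  map_inf : ∀ x y : M, f (x ⊓ y) = f x ⊓ f y
  map_oplus : ∀ x y : M, f (oplus x y) = oplus (f x) (f y)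
  map_bot : f ⊥ = ⊥
  map_lam : ∀ b x : M, IsIdem b → x ≤ b → f (lam b x) = lam (f b) (f x)

/-- The truncated addition `x ⊕ y = min (x + y) 1` on the real interval `[0, 1]`. -/
noncomputable def unitOplus (x y : unitInterval) : unitInterval :=
  ⟨min ((x : ℝ) + y) 1, le_min (add_nonneg x.2.1 y.2.1) zero_le_one, min_le_right _ _⟩

/-- The truncated difference `max (a - x) 0` on `[0, 1]`; it is `λ_a(x)` for `x ≤ a ∈ {0, 1}`. -/
noncomputable def unitDiff (a x : unitInterval) : unitInterval :=
  ⟨max ((a : ℝ) - x) 0, le_max_right _ _,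
    max_le ((sub_le_self _ x.2.1).trans a.2.2) zero_le_one⟩

theorem coe_unitOplus (x y : unitInterval) :
    ((unitOplus x y : unitInterval) : ℝ) = min ((x : ℝ) + y) 1 := rfl

theorem coe_unitDiff (a x : unitInterval) :
    ((unitDiff a x : unitInterval) : ℝ) = max ((a : ℝ) - x) 0 := rfl

theorem unit_bot : ((⊥ : unitInterval) : ℝ) = 0 := rfl

/-- The EMV-algebra of the real interval `[0, 1]`, with `x ⊕ y = min (x + y) 1`. -/
noncomputable instance : EMVAlgebra unitInterval where
  oplus := unitOplus
  oplus_assoc x y z := by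
    have := x.2.1; have := y.2.1; have := z.2.1
    apply Subtype.ext
    simp only [coe_unitOplus]
    grind
  oplus_comm x y := by
    apply Subtype.ext
    simp only [coe_unitOplus, add_comm]
  oplus_bot x := by
    have := x.2.2
    apply Subtype.ext
    simp only [coe_unitOplus, unit_bot]
    grind
  oplus_mono x y z h := by
    have h' : (x : ℝ) ≤ y := h
    change min ((x : ℝ) + z) 1 ≤ min ((y : ℝ) + z) 1
    gcongr
  interval a ha := by
    have ha' : (a : ℝ) = 0 ∨ (a : ℝ) = 1 := by
      have h := congrArg Subtype.val ha
      rw [coe_unitOplus] at h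
      grind
    refine ⟨unitDiff a, ?_, ?_⟩
    · intro x hx
      have hx' : (x : ℝ) ≤ a := hx
      have := x.2.1
      refine ⟨⟨?_, ?_⟩, ?_⟩
      · change max ((a : ℝ) - x) 0 ≤ a
        grind
      · apply Subtype.ext
        simp only [coe_unitOplus, coe_unitDiff]
        grind
      · rintro z ⟨_, hz⟩
        have h := congrArg Subtype.val hz
        rw [coe_unitOplus] at h
        have := z.2.1
        change max ((a : ℝ) - x) 0 ≤ z
        grind
    · have e : ∀ x ∈ Set.Iic a, 0 ≤ (x : ℝ) ∧ (x : ℝ) ≤ a := fun x hx => ⟨x.2.1, hx⟩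
      constructor
      · exact bot_le (a := a)
      · exact le_refl a
      · intro x hx y hy
        change min ((x : ℝ) + y) 1 ≤ a
        grind
      · intro x hx
        change max ((a : ℝ) - x) 0 ≤ a
        grind
      all_goals intros; apply Subtype.ext; simp only [coe_unitOplus, coe_unitDiff, unit_bot]; grind
  exists_idempotent x := by
    refine ⟨1, ?_, x.2.2⟩
    apply Subtype.ext
    simp only [coe_unitOplus]
    norm_num

variable (M : Type u) [DistribLattice M] [OrderBot M] [EMVAlgebra M]

/-- State-morphisms: EMV-homomorphisms `s : M → [0, 1]` that attain the value `1`. -/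
def StateMorphism : Type u := {s : M → unitInterval // IsEMVHom s ∧ ∃ x : M, s x = 1}

/-- The weak topology: the subspace topology of the product topology of `[0, 1]^M`. -/
instance : TopologicalSpace (StateMorphism M) :=
  inferInstanceAs (TopologicalSpace {s : M → unitInterval // IsEMVHom s ∧ ∃ x : M, s x = 1})

variable {M}

/-- `Ker(s) = {x ∈ M | s(x) = 0}`. -/
def StateMorphism.ker (s : StateMorphism M) : Set M := {x | s.1 x = 0}

end EMVAlgebra

/-! The heart is the bijectivity of `Ker`. For a maximal ideal `A`, which is prime, prelinearity `(x
⊖ y) ∧ (y ⊖ x) = 0` makes `M / A` totally ordered. Modulo `A`, every idempotent outside `A` becomes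
the largest element. So `M / A` is an MV-chain even if `M` has no top (`quotientMVChain`). A
nontrivial MV-chain maps homomorphically to `[0,1]` by reading off binary digits: `MVChain.value`
doubles `x` below the midpoint and replaces it by `2x - 1` above. Identities for `value` hold up to
`2⁻ⁿ` for every `n`, because one doubling step reduces each to an identity of the same kind with
twice the error. By maximality no class of an element outside `A` is infinitesimal, so the kernel of
the composite is exactly `A`. The same halving argument shows that a state-morphism is determined by
its kernel (`le_of_ker_subset`).

For the topologies, `toMaxI` is continuous, `MaxI M` is Hausdorff by prelinearity and primeness, and
each set `{s | s b = 1}` is compact, being closed in the cube `[0,1]^M`. These sets, for idempotent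
`b`, are open and cover the space, so a local form of "a continuous bijection from a compact space
to a Hausdorff space is a homeomorphism" shows that `toMaxI` is open.

A top `t` makes the whole space `{s | s t = 1}`, hence compact. Conversely, compactness of `MaxI M`
yields one idempotent outside every maximal ideal, and such an idempotent must be the top. -/

/-- A linearly ordered MV-algebra, written additively: `x + y` is the truncated sum, `-x` the
negation and `⊤` the unit. -/
class MVChain (C : Type u) extends AddCommMonoid C, LinearOrder C, IsOrderedAddMonoid C,
    OrderTop C, Neg C where
  zero_le' : ∀ x : C, 0 ≤ x
  neg_neg' : ∀ x : C, - -x = x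
  le_iff' : ∀ x y : C, x ≤ y ↔ -x + y = ⊤
  add_neg_add' : ∀ x y : C, x ≤ y → x + -(-y + x) = y

/-! ### Arithmetic in MV-chains -/

namespace MVChain

variable {C : Type u} [MVChain C]

theorem neg_anti {x y : C} (h : x ≤ y) : -y ≤ -x := by
  rw [le_iff', neg_neg', add_comm]
  exact (le_iff' x y).1 h

theorem le_neg_comm {x y : C} (h : x ≤ -y) : y ≤ -x := by
  simpa only [neg_neg'] using neg_anti h

theorem neg_add_self (x : C) : -x + x = ⊤ := (le_iff' x x).1 le_rfl

theorem le_self_add' (x y : C) : x ≤ x + y := by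
  simpa using add_le_add_right (zero_le' y) x

theorem neg_top : -(⊤ : C) = 0 := by
  refine le_antisymm ?_ (zero_le' _)
  rw [le_iff', neg_neg', add_zero]

theorem neg_zero' : -(0 : C) = ⊤ := by rw [← neg_top, neg_neg']

/-- Cancellation of a summand in a sum without overflow. -/
theorem neg_add_add {x z : C} (h : x ≤ -z) : -(x + z) + z = -x := by
  have := add_neg_add' z (-x) (le_neg_comm h)
  rwa [neg_neg', add_comm] at this

theorem le_neg_add {a b c : C} (h : a ≤ -b) (h' : a + b ≤ -c) : a ≤ -(b + c) := by
  apply le_neg_comm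
  rw [← neg_add_add h, add_comm b c]
  exact add_le_add_left (le_neg_comm h') b

/-- Both sides are the truncation of `2 - u - v - z`: without overflow, `z` may move from one
summand to the other. -/
theorem neg_neg_add_shift {u v z : C} (hu : u ≤ -z) (hv : v ≤ -z) :
    -(u + z) + -v = -u + -(v + z) := by
  rw [← neg_add_add hv, ← neg_add_add hu]
  exact (add_assoc _ _ _).symm.trans (add_right_comm _ _ _)

/-- The truncated square `x ⊙ x`, that is `max (2 x - 1) 0`. -/
def sq (x : C) : C := -(-x + -x)

theorem sq_mono {x y : C} (h : x ≤ y) : sq x ≤ sq y :=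
  neg_anti (add_le_add (neg_anti h) (neg_anti h))

theorem add_self_of_neg_le {x : C} (h : -x ≤ x) : x + x = ⊤ := (le_iff' (-x) x).1 h ▸ by
  rw [neg_neg']

theorem sq_of_le_neg {x : C} (h : x ≤ -x) : sq x = 0 := by
  rw [sq, (le_iff' x (-x)).1 h, neg_top]

/-- Below the midpoint, `2(x + y) - 1` is the MV-product of `2x` and `2y`. With `z = y - x` it comes
from shifting `z` between `x + x` and `x + y`. -/
theorem sq_add_of_le {x y : C} (hxy : x ≤ y) (hy : y ≤ -y) :
    sq (x + y) = -(-(x + x) + -(y + y)) := by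
  obtain ⟨z, hz⟩ : ∃ z, x + z = y := ⟨_, add_neg_add' x y hxy⟩
  have hzy : z ≤ y := by rw [← hz, add_comm]; exact le_self_add' z x
  have hyx : y ≤ -x := hy.trans (neg_anti hxy)
  have hzx : z ≤ -x := hzy.trans hyx
  have hzx' : z + x = y := by rw [add_comm, hz]
  have h1 : z ≤ -(x + x) := le_neg_add hzx (hzx' ▸ hyx)
  have h2 : z ≤ -(x + y) := le_neg_add hzx (hzx' ▸ hy)
  have e1 : x + x + z = x + y := by rw [add_assoc, hz]
  have e2 : x + y + z = y + y := by rw [add_right_comm, hz]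
  have h := neg_neg_add_shift (u := x + x) (v := x + y) (le_neg_comm h1) (le_neg_comm h2)
  rw [e1, e2] at h
  rw [sq, h]

theorem sq_add_of_neg_le {x y : C} (hy : -y ≤ y) :
    sq (x + y) = x + x + sq y := by
  rcases le_total (-y) x with h | h
  · have e : x + y = ⊤ := top_le_iff.1 ((neg_add_self y).symm.le.trans (add_le_add_left h y))
    rw [e, sq, neg_top, add_zero, neg_zero']
    symm
    rw [← top_le_iff, ← neg_add_self (-y + -y), add_comm (x + x)]
    exact add_le_add_right (add_le_add h h) _
  · have hw := add_neg_add' x (-y) h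
    rw [neg_neg', add_comm y x] at hw
    -- Here `x + w = -y`, so `-y + -y` is the overflow-free sum of `w + w` and `x + x`; cancelling
    -- `x + x` gives the claim.
    set w := -(x + y)
    have ht : x + w ≤ -(x + w) := by rw [hw, neg_neg']; exact hy
    have hwx : w ≤ -x := by
      have : w ≤ x + w := by rw [add_comm]; exact le_self_add' _ _
      exact (this.trans ht).trans (neg_anti (le_self_add' _ _))
    have h1 : w ≤ -(x + (x + w)) := le_neg_add hwx (by rwa [add_comm w x])
    have h2 : x + x + w ≤ -w := by rw [add_assoc]; exact le_neg_comm h1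
    have h3 : x + x ≤ -w := (le_self_add' _ _).trans h2
    have h4 : w + w ≤ -(x + x) := le_neg_comm (le_neg_add h3 h2)
    have h5 := neg_add_add h4
    have e : w + w + (x + x) = -y + -y := by rw [← hw]; abel
    rw [e] at h5
    change -(w + w) = _
    rw [← h5, add_comm, sq]

/-! ### The binary expansion as a homomorphism to the real unit interval -/

open Classical in
/-- One step of the binary expansion. -/
noncomputable def step (x : C) : C := if -x ≤ x then sq x else x + x

open Classical in
/-- The first binary digit. -/
noncomputable def digit (x : C) : ℝ := if -x ≤ x then 1 else 0

/-- The real number in `[0, 1]` with the binary expansion of `x`. -/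
noncomputable def value (x : C) : ℝ := ∑' n : ℕ, digit (step^[n] x) * (1 / 2 / 2 ^ n)

theorem digit_nonneg (x : C) : 0 ≤ digit x := by unfold digit; split_ifs <;> norm_num

theorem digit_le_one (x : C) : digit x ≤ 1 := by unfold digit; split_ifs <;> norm_num

theorem digit_mul_le (x : C) (n : ℕ) : digit x * (1 / 2 / 2 ^ n) ≤ 1 / 2 / 2 ^ n :=
  mul_le_of_le_one_left (by positivity) (digit_le_one x)

theorem summable_digit (x : C) :
    Summable fun n : ℕ => digit (step^[n] x) * ((1 : ℝ) / 2 / 2 ^ n) :=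
  Summable.of_nonneg_of_le (fun _ => mul_nonneg (digit_nonneg _) (by positivity))
    (fun _ => digit_mul_le _ _) (summable_geometric_two' 1)

theorem value_nonneg (x : C) : 0 ≤ value x :=
  tsum_nonneg fun _ => mul_nonneg (digit_nonneg _) (by positivity)

theorem value_le_one (x : C) : value x ≤ 1 :=
  ((summable_digit x).tsum_le_tsum (fun _ => digit_mul_le _ _)
    (summable_geometric_two' 1)).trans_eq (tsum_geometric_two' 1)

theorem value_eq (x : C) : value x = (digit x + value (step x)) / 2 := by
  rw [value, (summable_digit x).tsum_eq_zero_add, value, add_div, ← tsum_div_const]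
  congr 1
  · simp; ring
  · congr 1
    funext n
    rw [Function.iterate_succ_apply, pow_succ]
    field_simp

theorem value_of_neg_le {x : C} (h : -x ≤ x) : value x = (1 + value (sq x)) / 2 := by
  rw [value_eq, digit, step, if_pos h, if_pos h]

theorem value_top : value (⊤ : C) = 1 := by
  have h := value_of_neg_le (le_top : -(⊤ : C) ≤ ⊤)
  rw [sq, neg_top, add_zero, neg_zero'] at h
  linarith

section Nontrivial

variable [Nontrivial C]

theorem not_top_le_zero : ¬ (⊤ : C) ≤ 0 := by
  intro h
  obtain ⟨x, y, hxy⟩ := exists_pair_ne C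
  have h0 : ∀ z : C, z = 0 := fun z => le_antisymm (le_top.trans h) (zero_le' z)
  exact hxy ((h0 x).trans (h0 y).symm)

theorem value_zero : value (0 : C) = 0 := by
  have h : ¬ -(0 : C) ≤ 0 := by rw [neg_zero']; exact not_top_le_zero
  have e := value_eq (0 : C)
  rw [digit, step, if_neg h, if_neg h, add_zero] at e
  linarith

/-- At the midpoint `x = -x` the digit is 1, yet the doubling rule still applies: both rules give
`1/2`. -/
theorem value_of_le_neg {x : C} (h : x ≤ -x) : value x = value (x + x) / 2 := by
  by_cases h' : -x ≤ x
  · rw [value_of_neg_le h', sq_of_le_neg h, add_self_of_neg_le h', value_zero, value_top]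
    norm_num
  · rw [value_eq, digit, step, if_neg h', if_neg h', zero_add]

theorem le_of_forall_half_pow {a b : ℝ} (h : ∀ n : ℕ, a ≤ b + (1 / 2) ^ n) : a ≤ b := by
  refine le_of_forall_pos_le_add fun ε hε => ?_
  obtain ⟨n, hn⟩ := exists_pow_lt_of_lt_one hε (by norm_num : (1 / 2 : ℝ) < 1)
  linarith [h n]

theorem value_mono {x y : C} (hxy : x ≤ y) : value x ≤ value y := by
  refine le_of_forall_half_pow fun n => ?_
  induction n generalizing x y with
  | zero => rw [pow_zero]; linarith [value_le_one x, value_nonneg y]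
  | succ n ih =>
    rw [pow_succ]
    rcases le_total (-x) x with hx | hx
    · have hy : -y ≤ y := (neg_anti hxy).trans (hx.trans hxy)
      rw [value_of_neg_le hx, value_of_neg_le hy]
      linarith [ih (sq_mono hxy)]
    · rw [value_of_le_neg hx]
      rcases le_total (-y) y with hy | hy
      · rw [value_of_neg_le hy]
        have : (0 : ℝ) ≤ (1 / 2) ^ n := by positivity
        linarith [value_le_one (x + x), value_nonneg (sq y)]
      · rw [value_of_le_neg hy]
        linarith [ih (add_le_add hxy hxy)]

/-- Negation exchanges the two halves of the chain and `-(sq x) = -x + -x`, so a doubling step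
halves the error. -/
theorem abs_value_neg (n : ℕ) : ∀ x : C, |value (-x) + value x - 1| ≤ (1 / 2) ^ n := by
  induction n with
  | zero =>
    intro x
    rw [pow_zero, abs_le]
    constructor <;> linarith [value_le_one x, value_nonneg x, value_le_one (-x),
      value_nonneg (-x)]
  | succ n ih =>
    have key : ∀ x : C, -x ≤ x → |value (-x) + value x - 1| ≤ (1 / 2) ^ (n + 1) := by
      intro x hx
      rw [value_of_neg_le hx, value_of_le_neg (x := -x) (by rwa [neg_neg']), pow_succ]
      have h := ih (sq x)
      rw [sq, neg_neg', abs_le] at h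
      rw [sq, abs_le]
      constructor <;> linarith
    intro x
    rcases le_total (-x) x with hx | hx
    · exact key x hx
    · have := key (-x) (by rwa [neg_neg'])
      rwa [neg_neg', add_comm (value x)] at this

theorem value_neg (x : C) : value (-x) = 1 - value x := by
  have h := fun n => abs_le.1 (abs_value_neg n x)
  apply le_antisymm <;> refine le_of_forall_half_pow fun n => ?_ <;> linarith [(h n).1, (h n).2]

/-- The condition `x ≤ -y` excludes overflow. Doubling yields another overflow-free sum with half
the error, according to where `y` and `x + y` lie relative to the midpoint. -/
theorem abs_value_add (n : ℕ) :
    ∀ x y : C, x ≤ -y → |value (x + y) - value x - value y| ≤ (1 / 2) ^ n := by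
  induction n with
  | zero =>
    intro x y h
    have := value_mono h
    rw [value_neg] at this
    rw [pow_zero, abs_le]
    constructor <;> linarith [value_le_one x, value_nonneg x, value_le_one y,
      value_nonneg y, value_le_one (x + y), value_nonneg (x + y)]
  | succ n ih =>
    have key : ∀ x y : C, x ≤ y → x ≤ -y →
        |value (x + y) - value x - value y| ≤ (1 / 2) ^ (n + 1) := by
      intro x y hxy h
      rw [pow_succ]
      have hx : x ≤ -x := h.trans (neg_anti hxy)
      rcases le_total (-y) y with hy | hy
      · have hs : -(x + y) ≤ x + y := by
          have : y ≤ x + y := by rw [add_comm]; exact le_self_add' _ _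
          exact (neg_anti this).trans (hy.trans this)
        rw [value_of_neg_le hs, value_of_le_neg hx, value_of_neg_le hy, sq_add_of_neg_le hy]
        have := ih (x + x) (sq y) (by rw [sq, neg_neg']; exact add_le_add h h)
        rw [abs_le] at this ⊢
        constructor <;> linarith
      · rw [value_of_le_neg hx, value_of_le_neg hy]
        rcases le_total (-(x + y)) (x + y) with hs | hs
        · rw [value_of_neg_le hs, sq_add_of_le hxy hy, value_neg]
          -- The doubles `x + x` and `y + y` may overflow when added, but their negations do not.
          have := ih (-(x + x)) (-(y + y)) (by
            rw [neg_neg', le_iff', neg_neg', add_add_add_comm]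
            exact add_self_of_neg_le hs)
          rw [value_neg, value_neg] at this
          rw [abs_le] at this ⊢
          constructor <;> linarith
        · rw [value_of_le_neg hs, add_add_add_comm]
          have h1 : y ≤ -(x + (x + y)) :=
            le_neg_add (le_neg_comm h) (by rwa [add_comm y x])
          have h2 : x + x + y ≤ -y := by rw [add_assoc]; exact le_neg_comm h1
          have := ih (x + x) (y + y) (le_neg_add ((le_self_add' _ _).trans h2) h2)
          rw [abs_le] at this ⊢
          constructor <;> linarith
    intro x y h
    rcases le_total x y with hxy | hxy
    · exact key x y hxy h
    · have := key y x hxy (le_neg_comm h)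
      rwa [add_comm y x, sub_right_comm] at this

theorem value_add (x y : C) : value (x + y) = min (value x + value y) 1 := by
  rcases le_total x (-y) with h | h
  · have h' := fun n => abs_le.1 (abs_value_add n x y h)
    have e : value (x + y) = value x + value y := by
      apply le_antisymm <;> refine le_of_forall_half_pow fun n => ?_ <;>
        linarith [(h' n).1, (h' n).2]
    rw [← e, min_eq_left (value_le_one _)]
  · have e : x + y = ⊤ := top_le_iff.1 ((neg_add_self y).symm.le.trans (add_le_add_left h y))
    have := value_mono h
    rw [value_neg] at this
    rw [e, value_top, min_eq_right (by linarith)]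

theorem value_ne_zero {x : C} (h : ∃ n : ℕ, n • x = ⊤) : value x ≠ 0 := by
  obtain ⟨n, hn⟩ := h
  intro h0
  have : ∀ n : ℕ, value (n • x) = 0 := by
    intro n
    induction n with
    | zero => rw [zero_nsmul, value_zero]
    | succ n ih => rw [succ_nsmul, value_add, ih, h0]; norm_num
  have h1 := this n
  rw [hn, value_top] at h1
  exact one_ne_zero h1

end Nontrivial

end MVChain

namespace EMVAlgebra

/-! ### The quotient by a maximal ideal -/

section Quotient

variable {M : Type u} [DistribLattice M] [OrderBot M] [EMVAlgebra M]

local infixl:65 " ⊕ₑ " => EMVAlgebra.oplus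

theorem bot_oplus (x : M) : ⊥ ⊕ₑ x = x := by rw [oplus_comm, oplus_bot]

theorem oplus_oplus_oplus_comm (x y z w : M) : x ⊕ₑ y ⊕ₑ (z ⊕ₑ w) = x ⊕ₑ z ⊕ₑ (y ⊕ₑ w) := by
  rw [oplus_assoc, oplus_assoc, ← oplus_assoc y, oplus_comm y z, oplus_assoc]

theorem exists_isIdem_le (x y : M) : ∃ b : M, IsIdem b ∧ x ≤ b ∧ y ≤ b := by
  obtain ⟨b, hb, h⟩ := exists_idempotent (x ⊔ y)
  exact ⟨b, hb, le_sup_left.trans h, le_sup_right.trans h⟩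

theorem IsIdem.oplus_le {a x y : M} (ha : IsIdem a) (hx : x ≤ a) (hy : y ≤ a) : x ⊕ₑ y ≤ a :=
  (oplus_le_oplus hx hy).trans_eq ha

theorem lam_le_self {a x : M} (ha : IsIdem a) (hx : x ≤ a) : lam a x ≤ a :=
  (isLeast_lam ha hx).1.1

theorem lam_oplus {a x : M} (ha : IsIdem a) (hx : x ≤ a) : lam a x ⊕ₑ x = a :=
  (isLeast_lam ha hx).1.2

theorem lam_lam {a x : M} (ha : IsIdem a) (hx : x ≤ a) : lam a (lam a x) = x :=
  (isMVAlgebraOn_Iic ha).neg_neg x hx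

theorem oplus_inf_idem {e : M} (he : IsIdem e) (x y : M) :
    (x ⊕ₑ y) ⊓ e = (x ⊓ e) ⊕ₑ (y ⊓ e) := by
  apply le_antisymm
  · rw [inf_comm, inf_comm x, inf_comm y]
    exact inf_oplus_le e x y
  · exact le_inf (oplus_le_oplus inf_le_left inf_le_left)
      (he.oplus_le inf_le_right inf_le_right)

/-- Residuation in the interval `[⊥, b]`. -/
theorem lam_le_iff {b x z : M} (hb : IsIdem b) (hx : x ≤ b) : lam b x ≤ z ↔ b ≤ z ⊕ₑ x := by
  constructor
  · intro h
    exact (lam_oplus hb hx).symm.le.trans (oplus_le_oplus h le_rfl)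
  · intro h
    refine ((isLeast_lam hb hx).2 ⟨inf_le_right, ?_⟩ : lam b x ≤ z ⊓ b).trans inf_le_left
    have := oplus_inf_idem hb z x
    rw [inf_eq_left.2 hx, inf_eq_right.2 h] at this
    exact this.symm

theorem lam_anti {b x y : M} (hb : IsIdem b) (hy : y ≤ b) (hxy : x ≤ y) : lam b y ≤ lam b x := by
  rw [lam_le_iff hb hy]
  exact (lam_oplus hb (hxy.trans hy)).symm.le.trans (oplus_le_oplus le_rfl hxy)

theorem lam_self {b : M} (hb : IsIdem b) : lam b b = ⊥ := by
  rw [← le_bot_iff, lam_le_iff hb le_rfl, bot_oplus]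

/-- This is `x ⊕ (y ⊖ x) = y`: the Łukasiewicz axiom swaps the roles, and `x ⊖ y = ⊥`. -/
theorem oplus_lam_oplus_lam {b x y : M} (hb : IsIdem b) (hy : y ≤ b) (hxy : x ≤ y) :
    x ⊕ₑ lam b (x ⊕ₑ lam b y) = y := by
  rw [(isMVAlgebraOn_Iic hb).lukasiewicz x (hxy.trans hy) y hy]
  have : y ⊕ₑ lam b x = b := by
    rw [oplus_comm]
    exact (le_iff_lam hb (hxy.trans hy) hy).1 hxy
  rw [this, lam_self hb, oplus_bot]

/-- Cancellation of `d`, legitimate because `w ≤ lam b d` rules out overflow. -/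
theorem eq_bot_of_oplus_le {b d w : M} (hb : IsIdem b) (hd : d ≤ b) (hw : w ≤ lam b d)
    (h : d ⊕ₑ w ≤ d) : w = ⊥ := by
  have hwb : w ≤ b := hw.trans (lam_le_self hb hd)
  have hdw : d ≤ lam b w := by
    have := lam_anti hb (lam_le_self hb hd) hw
    rwa [lam_lam hb hd] at this
  have h1 := oplus_lam_oplus_lam hb (lam_le_self hb hwb) hdw
  rw [lam_lam hb hwb, le_antisymm h (le_oplus_left d w), oplus_comm, lam_oplus hb hd] at h1
  rw [← lam_lam hb hwb, ← h1, lam_self hb]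

theorem inf_lam_idem {b e : M} (hb : IsIdem b) (he : IsIdem e) (heb : e ≤ b) :
    e ⊓ lam b e = ⊥ :=
  eq_bot_of_oplus_le hb heb inf_le_right (he.oplus_le le_rfl inf_le_left)

/-- Prelinearity, `(x ⊖ y) ∧ (y ⊖ x) = 0`. Added to `x ⊓ y`, the meet stays below both `x` and `y`,
hence below `x ⊓ y`, so it cancels to `⊥`. -/
theorem lam_inf_lam {b x y : M} (hb : IsIdem b) (hx : x ≤ b) (hy : y ≤ b) :
    lam b (lam b x ⊕ₑ y) ⊓ lam b (lam b y ⊕ₑ x) = ⊥ := by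
  have key : ∀ u v : M, u ≤ b → v ≤ b →
      lam b (lam b u ⊕ₑ v) ⊕ₑ (u ⊓ v) ≤ u ∧ lam b (lam b u ⊕ₑ v) ≤ lam b (u ⊓ v) := by
    intro u v hu hv
    have hd : u ⊓ v ≤ b := inf_le_left.trans hu
    have hlu := lam_le_self hb hu
    have hle : lam b (lam b u ⊕ₑ v) ≤ lam b (lam b u ⊕ₑ (u ⊓ v)) := by
      rw [lam_le_iff hb (hb.oplus_le hlu hv)]
      set t := lam b (lam b u ⊕ₑ (u ⊓ v))
      have h1 : b ≤ t ⊕ₑ lam b u ⊕ₑ (u ⊓ v) := by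
        rw [oplus_assoc]
        exact (lam_le_iff hb (hb.oplus_le hlu hd)).1 le_rfl
      rw [← oplus_assoc]
      exact h1.trans (oplus_le_oplus le_rfl inf_le_right)
    constructor
    · refine (oplus_le_oplus hle le_rfl).trans ?_
      rw [oplus_comm, oplus_comm (lam b u), oplus_lam_oplus_lam hb hu inf_le_left]
    · refine hle.trans (lam_anti hb (hb.oplus_le hlu hd) (le_oplus_right _ _))
  obtain ⟨h1, h2⟩ := key x y hx hy
  obtain ⟨h3, -⟩ := key y x hy hx
  rw [inf_comm y x] at h3
  refine eq_bot_of_oplus_le hb (inf_le_left.trans hx : x ⊓ y ≤ b) (inf_le_left.trans h2) ?_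
  rw [oplus_comm]
  exact le_inf ((oplus_le_oplus inf_le_left le_rfl).trans h1)
    ((oplus_le_oplus inf_le_right le_rfl).trans h3)

theorem IsMaximalIdeal.exists_isIdem {A : Set M} (hA : IsMaximalIdeal A) :
    ∃ e : M, IsIdem e ∧ e ∉ A := by
  obtain ⟨x, hx⟩ := (Set.ne_univ_iff_exists_notMem A).1 hA.ne_univ
  obtain ⟨e, he, hxe⟩ := exists_idempotent x
  exact ⟨e, he, fun h => hx (hA.isIdeal.lower _ _ hxe h)⟩

theorem IsMaximalIdeal.lam_mem {A : Set M} (hA : IsMaximalIdeal A) {b e : M} (hb : IsIdem b)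
    (he : IsIdem e) (heA : e ∉ A) (heb : e ≤ b) : lam b e ∈ A :=
  (hA.prime (by rw [inf_lam_idem hb he heb]; exact hA.isIdeal.bot_mem)).resolve_left heA

/-- The order modulo `A`. -/
def LeMod (A : Set M) (x y : M) : Prop := ∃ a ∈ A, x ≤ y ⊕ₑ a

theorem LeMod.trans {A : Set M} (hA : IsIdeal A) {x y z : M} (h : LeMod A x y)
    (h' : LeMod A y z) : LeMod A x z := by
  obtain ⟨a, ha, h⟩ := h
  obtain ⟨a', ha', h'⟩ := h'
  refine ⟨a' ⊕ₑ a, hA.oplus_mem _ _ ha' ha, h.trans ?_⟩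
  rw [← oplus_assoc]
  exact oplus_le_oplus h' le_rfl

theorem leMod_of_le {A : Set M} (hA : IsIdeal A) {x y : M} (h : x ≤ y) : LeMod A x y :=
  ⟨⊥, hA.bot_mem, by rwa [oplus_bot]⟩

theorem LeMod.oplus {A : Set M} (hA : IsIdeal A) {x y z w : M} (h : LeMod A x y)
    (h' : LeMod A z w) : LeMod A (x ⊕ₑ z) (y ⊕ₑ w) := by
  obtain ⟨a, ha, h⟩ := h
  obtain ⟨a', ha', h'⟩ := h'
  refine ⟨a ⊕ₑ a', hA.oplus_mem _ _ ha ha', ?_⟩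
  rw [oplus_oplus_oplus_comm]
  exact oplus_le_oplus h h'

theorem leMod_bot {A : Set M} (hA : IsIdeal A) {x : M} : LeMod A x ⊥ ↔ x ∈ A := by
  constructor
  · rintro ⟨a, ha, h⟩
    rw [bot_oplus] at h
    exact hA.lower _ _ h ha
  · exact fun h => ⟨x, h, le_oplus_right _ _⟩

theorem IsMaximalIdeal.leMod_total {A : Set M} (hA : IsMaximalIdeal A) (x y : M) :
    LeMod A x y ∨ LeMod A y x := by
  obtain ⟨b, hb, hx, hy⟩ := exists_isIdem_le x y
  have key : ∀ u v : M, u ≤ b → v ≤ b → lam b (lam b u ⊕ₑ v) ∈ A → LeMod A u v := by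
    intro u v hu hv h
    refine ⟨_, h, ?_⟩
    have h1 := lam_oplus hb (hb.oplus_le (lam_le_self hb hu) hv)
    rw [← lam_lam hb hu, lam_le_iff hb (lam_le_self hb hu), lam_lam hb hu, oplus_comm,
      ← oplus_assoc, oplus_comm]
    exact h1.symm.le
  have h := lam_inf_lam hb hx hy
  refine (hA.prime (h ▸ hA.isIdeal.bot_mem)).imp (key x y hx hy) (key y x hy hx)

/-- Any idempotent outside `A` is a largest element modulo `A`: within a larger idempotent `b`,
primeness puts its complement in `A`. -/
theorem IsMaximalIdeal.leMod_inf {A : Set M} (hA : IsMaximalIdeal A) {e : M} (he : IsIdem e)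
    (heA : e ∉ A) (x : M) : LeMod A x (x ⊓ e) := by
  obtain ⟨b, hb, hx, heb⟩ := exists_isIdem_le x e
  refine ⟨_, hA.lam_mem hb he heA heb, ?_⟩
  have h : x ≤ e ⊕ₑ lam b e := by rw [oplus_comm, lam_oplus hb heb]; exact hx
  exact ((le_inf le_rfl h).trans (inf_oplus_le x e (lam b e))).trans
    (oplus_le_oplus le_rfl inf_le_right)

/-- Congruence modulo an ideal. -/
def modSetoid {A : Set M} (hA : IsIdeal A) : Setoid M where
  r x y := LeMod A x y ∧ LeMod A y x
  iseqv :=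
    { refl := fun _ => ⟨leMod_of_le hA le_rfl, leMod_of_le hA le_rfl⟩
      symm := fun h => ⟨h.2, h.1⟩
      trans := fun h h' => ⟨h.1.trans hA h'.1, h'.2.trans hA h.2⟩ }

theorem lam_inf_leMod {A : Set M} {e x y : M} (he : IsIdem e)
    (h : LeMod A x y) : LeMod A (lam e (y ⊓ e)) (lam e (x ⊓ e)) := by
  obtain ⟨a, ha, h⟩ := h
  refine ⟨a, ha, ?_⟩
  rw [lam_le_iff he inf_le_right, oplus_assoc]
  have h1 : x ⊓ e ≤ a ⊕ₑ (y ⊓ e) := by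
    refine (inf_le_inf_right e h).trans ?_
    rw [oplus_inf_idem he, oplus_comm]
    exact oplus_le_oplus inf_le_left le_rfl
  exact (lam_oplus he inf_le_right).symm.le.trans (oplus_le_oplus le_rfl h1)

/-- The quotient of `M` by an ideal. -/
def ModQuotient {A : Set M} (hA : IsIdeal A) : Type u := Quotient (modSetoid hA)

/-- The quotient by a maximal ideal is a linearly ordered MV-algebra. -/
noncomputable abbrev quotientMVChain {A : Set M} (hA : IsMaximalIdeal A) {e : M} (he : IsIdem e)
    (heA : e ∉ A) : MVChain (ModQuotient hA.isIdeal) :=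
  letI : Setoid M := modSetoid hA.isIdeal
  have hI := hA.isIdeal
  letI : Add (ModQuotient hI) :=
    ⟨Quotient.map₂ oplus fun _ _ h _ _ h' => ⟨h.1.oplus hI h'.1, h.2.oplus hI h'.2⟩⟩
  letI : Zero (ModQuotient hI) := ⟨⟦⊥⟧⟩
  letI : LE (ModQuotient hI) :=
    ⟨Quotient.lift₂ (LeMod A) fun _ _ _ _ h h' => propext
      ⟨fun k => h.2.trans hI (k.trans hI h'.1), fun k => h.1.trans hI (k.trans hI h'.2)⟩⟩
  { nsmul := nsmulRec
    add_assoc := by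
      rintro ⟨x⟩ ⟨y⟩ ⟨z⟩
      exact congrArg (Quotient.mk _) (oplus_assoc x y z)
    zero_add := by
      rintro ⟨x⟩
      exact congrArg (Quotient.mk _) (bot_oplus x)
    add_zero := by
      rintro ⟨x⟩
      exact congrArg (Quotient.mk _) (oplus_bot x)
    add_comm := by
      rintro ⟨x⟩ ⟨y⟩
      exact congrArg (Quotient.mk _) (oplus_comm x y)
    lt := fun x y => x ≤ y ∧ ¬ y ≤ x
    lt_iff_le_not_ge := fun _ _ => Iff.rfl
    le_refl := by
      rintro ⟨x⟩
      exact leMod_of_le hI le_rfl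
    le_trans := by
      rintro ⟨x⟩ ⟨y⟩ ⟨z⟩ h h'
      exact LeMod.trans hI h h'
    le_antisymm := by
      rintro ⟨x⟩ ⟨y⟩ h h'
      exact Quotient.sound ⟨h, h'⟩
    le_total := by
      rintro ⟨x⟩ ⟨y⟩
      exact hA.leMod_total x y
    toDecidableLE := Classical.decRel _
    add_le_add_left := by
      rintro ⟨x⟩ ⟨y⟩ h ⟨z⟩
      exact LeMod.oplus hI h (leMod_of_le hI le_rfl)
    top := ⟦e⟧
    le_top := by
      rintro ⟨x⟩
      exact (hA.leMod_inf he heA x).trans hI (leMod_of_le hI inf_le_right)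
    -- Truncation at `e` brings `x` into `[⊥, e]`, where `lam e` is meaningful, without changing its
    -- class.
    neg := Quotient.map (fun x => lam e (x ⊓ e)) fun _ _ h =>
      ⟨lam_inf_leMod he h.2, lam_inf_leMod he h.1⟩
    zero_le' := by
      rintro ⟨x⟩
      exact leMod_of_le hI bot_le
    neg_neg' := by
      rintro ⟨x⟩
      apply Quotient.sound
      change LeMod A (lam e (lam e (x ⊓ e) ⊓ e)) x ∧ LeMod A x (lam e (lam e (x ⊓ e) ⊓ e))
      rw [inf_eq_left.2 (lam_le_self he inf_le_right), lam_lam he inf_le_right]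
      exact ⟨leMod_of_le hI inf_le_left, hA.leMod_inf he heA x⟩
    le_iff' := by
      rintro ⟨x⟩ ⟨y⟩
      have htop : ∀ z : M, (Quotient.mk (modSetoid hI) z = Quotient.mk _ e) ↔ LeMod A e z :=
        fun z => ⟨fun h => (Quotient.exact h).2, fun h => Quotient.sound
          ⟨(hA.leMod_inf he heA z).trans hI (leMod_of_le hI inf_le_right), h⟩⟩
      refine Iff.trans ?_ (htop _).symm
      have hlx := lam_le_self he (inf_le_right : x ⊓ e ≤ e)
      constructor
      · intro h
        have h1 : LeMod A (x ⊓ e) y := (leMod_of_le hI inf_le_left).trans hI h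
        have h2 := (leMod_of_le hI (le_refl (lam e (x ⊓ e)))).oplus hI h1
        rwa [lam_oplus he inf_le_right] at h2
      · rintro ⟨a, ha, h⟩
        refine (hA.leMod_inf he heA x).trans hI ⟨a, ha, ?_⟩
        rw [← lam_lam he (inf_le_right : x ⊓ e ≤ e), lam_le_iff he hlx, oplus_comm,
          ← oplus_assoc]
        exact h
    add_neg_add' := by
      rintro ⟨x⟩ ⟨y⟩ h
      have hX : x ⊓ e ≤ e := inf_le_right
      have hY : y ⊓ e ≤ e := inf_le_right
      have hlY := lam_le_self he hY
      have e1 : (lam e (y ⊓ e) ⊕ₑ x) ⊓ e = x ⊓ e ⊕ₑ lam e (y ⊓ e) := by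
        rw [oplus_inf_idem he, inf_eq_left.2 hlY, oplus_comm]
      apply Quotient.sound
      change LeMod A (x ⊕ₑ lam e ((lam e (y ⊓ e) ⊕ₑ x) ⊓ e)) y ∧
        LeMod A y (x ⊕ₑ lam e ((lam e (y ⊓ e) ⊕ₑ x) ⊓ e))
      rw [e1]
      constructor
      · refine ((hA.leMod_inf he heA x).oplus hI (leMod_of_le hI le_rfl)).trans hI ?_
        -- For the truncations `X`, `Y`, this turns `X ⊕ (Y ⊖ X)` into `Y ⊕ (X ⊖ Y)`, and `X ≤ Y ⊕
        -- a` gives `X ⊖ Y ≤ a ∈ A`.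
        rw [(isMVAlgebraOn_Iic he).lukasiewicz _ hX _ hY]
        obtain ⟨a, ha, h1⟩ : LeMod A (x ⊓ e) (y ⊓ e) :=
          (leMod_of_le hI inf_le_left).trans hI (LeMod.trans hI h (hA.leMod_inf he heA y))
        refine LeMod.trans hI ?_ (leMod_of_le hI (inf_le_left : y ⊓ e ≤ y))
        refine ⟨a, ha, oplus_le_oplus le_rfl ?_⟩
        rw [lam_le_iff he (he.oplus_le hY (lam_le_self he hX)), ← oplus_assoc,
          oplus_comm a, oplus_comm _ (lam e (x ⊓ e))]
        exact (lam_oplus he hX).symm.le.trans (oplus_le_oplus le_rfl h1)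
      · refine (hA.leMod_inf he heA y).trans hI (leMod_of_le hI ?_)
        refine le_trans ?_ (oplus_le_oplus (inf_le_left : x ⊓ e ≤ x) le_rfl)
        have hXY : x ⊓ e ⊕ₑ lam e (y ⊓ e) ≤ e := he.oplus_le hX hlY
        rw [← lam_lam he hY, lam_le_iff he hlY, lam_lam he hY, oplus_comm (x ⊓ e), oplus_assoc,
          oplus_comm]
        exact (lam_oplus he hXY).symm.le.trans_eq (oplus_comm _ _) }

end Quotient

/-! ### State-morphisms and their kernels -/

section States

variable {M : Type u} [DistribLattice M] [OrderBot M] [EMVAlgebra M]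

local infixl:65 " ⊕ₑ " => EMVAlgebra.oplus

theorem unit_lam {a x : unitInterval} (ha : IsIdem a) (hx : x ≤ a) : lam a x = unitDiff a x := by
  refine (isLeast_lam ha hx).unique ⟨⟨?_, ?_⟩, ?_⟩
  · have := x.2.1
    have := a.2.1
    change max ((a : ℝ) - x) 0 ≤ a
    grind
  · have hx' : (x : ℝ) ≤ a := hx
    have := a.2.2
    apply Subtype.ext
    change min (((unitDiff a x : unitInterval) : ℝ) + x) 1 = a
    rw [coe_unitDiff]
    grind
  · rintro z ⟨_, hz⟩
    have h : min ((z : ℝ) + x) 1 = a := congrArg Subtype.val hz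
    have := z.2.1
    change max ((a : ℝ) - x) 0 ≤ z
    grind

theorem unit_isIdem {a : unitInterval} (ha : IsIdem a) : a = 0 ∨ a = 1 := by
  have h : min ((a : ℝ) + a) 1 = a := congrArg Subtype.val ha
  have : (a : ℝ) = 0 ∨ (a : ℝ) = 1 := by grind
  exact this.imp (fun h => Subtype.ext h) fun h => Subtype.ext h

theorem unit_isIdem_one : IsIdem (1 : unitInterval) :=
  Subtype.ext (by change min ((1 : ℝ) + 1) 1 = 1; norm_num)

theorem IsEMVHom.mono {f : M → unitInterval} (hf : IsEMVHom f) {x y : M} (h : x ≤ y) :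
    f x ≤ f y := by
  rw [← inf_eq_left, ← hf.map_inf, inf_eq_left.2 h]

theorem IsEMVHom.isIdem {f : M → unitInterval} (hf : IsEMVHom f) {b : M} (hb : IsIdem b) :
    IsIdem (f b) := by
  rw [IsIdem, ← hf.map_oplus, hb]

theorem IsMaximalIdeal.exists_stateMorphism {A : Set M} (hA : IsMaximalIdeal A) :
    ∃ s : StateMorphism M, s.ker = A := by
  obtain ⟨e, he, heA⟩ := hA.exists_isIdem
  have hI := hA.isIdeal
  let := quotientMVChain hA he heA
  let π : M → ModQuotient hI := Quotient.mk _
  have hle : ∀ x y, π x ≤ π y ↔ LeMod A x y := fun _ _ =>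
    ⟨fun h => h, fun h => h⟩
  have hmono : ∀ x y, x ≤ y → π x ≤ π y := fun _ _ h => leMod_of_le hI h
  have hadd : ∀ x y, π (x ⊕ₑ y) = π x + π y := fun _ _ => rfl
  have hbot : π ⊥ = 0 := rfl
  have htop : ∀ b, IsIdem b → b ∉ A → π b = ⊤ := fun b hb hbA =>
    top_le_iff.1 ((hle e b).2
      ((hA.leMod_inf hb hbA e).trans hI (leMod_of_le hI inf_le_right)))
  have hzero : ∀ x, π x = 0 ↔ x ∈ A := fun x =>
    ⟨fun h => (leMod_bot hI).1 ((hle x ⊥).1 (h.trans hbot.symm).le),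
      fun h => le_antisymm ((hle x ⊥).2 ((leMod_bot hI).2 h)) (MVChain.zero_le' _)⟩
  have : Nontrivial (ModQuotient hI) :=
    ⟨π e, 0, fun h => heA ((hzero e).1 h)⟩
  have hsup : ∀ x y, π x ≤ π y → π (x ⊔ y) = π y := by
    intro x y h
    refine le_antisymm ?_ (hmono _ _ le_sup_right)
    obtain ⟨a, ha, h'⟩ := (hle x y).1 h
    exact (hle _ _).2 ⟨a, ha, sup_le h' (le_oplus_left _ _)⟩
  have hinf : ∀ x y, π x ≤ π y → π (x ⊓ y) = π x := by
    intro x y h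
    refine le_antisymm (hmono _ _ inf_le_left) ?_
    obtain ⟨a, ha, h'⟩ := (hle x y).1 h
    exact (hle _ _).2 ⟨a, ha, ((le_inf le_rfl h').trans (inf_oplus_le x y a)).trans
      (oplus_le_oplus le_rfl inf_le_right)⟩
  -- The quotient negation was built from `e`, but every idempotent outside `A` induces the same
  -- one.
  have hlam : ∀ b x, IsIdem b → b ∉ A → x ≤ b → π (lam b x) = -π x := by
    intro b x hb hbA hx
    apply le_antisymm
    · obtain ⟨a, ha, h⟩ : LeMod A b e :=
        (hA.leMod_inf he heA b).trans hI (leMod_of_le hI inf_le_right)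
      refine (hle _ (lam e (x ⊓ e))).2 ⟨a, ha, ?_⟩
      rw [lam_le_iff hb hx, oplus_assoc, oplus_comm a, ← oplus_assoc]
      refine h.trans (oplus_le_oplus ?_ le_rfl)
      exact (lam_oplus he inf_le_right).symm.le.trans (oplus_le_oplus le_rfl inf_le_left)
    · rw [MVChain.le_iff', MVChain.neg_neg', add_comm, ← hadd, lam_oplus hb hx, htop b hb hbA]
  have hpos : ∀ x, x ∉ A → ∃ n : ℕ, n • π x = ⊤ := by
    intro x hx
    -- `J` is an ideal containing `A` and `x`, so maximality makes it all of `M`; membership of `e`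
    -- then gives the multiple.
    let J : Set M := {z | ∃ n : ℕ, π z ≤ n • π x}
    have hJ : IsIdeal J :=
      { nonempty := ⟨⊥, 0, by rw [zero_nsmul, hbot]⟩
        lower := fun z w hzw ⟨n, hn⟩ => ⟨n, (hmono _ _ hzw).trans hn⟩
        oplus_mem := fun z w ⟨n, hn⟩ ⟨k, hk⟩ => ⟨n + k, by
          rw [hadd, add_nsmul]
          exact add_le_add hn hk⟩ }
    have hAJ : A ⊆ J := fun z hz => ⟨0, by rw [(hzero z).2 hz, zero_nsmul]⟩
    have hxJ : x ∈ J := ⟨1, by rw [one_nsmul]⟩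
    have hJu : J = Set.univ := by
      by_contra hne
      exact hx (hA.maximal J hJ hne hAJ ▸ hxJ)
    obtain ⟨n, hn⟩ : e ∈ J := hJu ▸ Set.mem_univ e
    exact ⟨n, top_le_iff.1 ((htop e he heA) ▸ hn)⟩
  let f : M → unitInterval := fun x =>
    ⟨MVChain.value (π x), MVChain.value_nonneg _, MVChain.value_le_one _⟩
  have hf0 : ∀ x, f x = 0 ↔ x ∈ A := by
    intro x
    constructor
    · intro h
      by_contra hx
      exact MVChain.value_ne_zero (hpos x hx) (congrArg Subtype.val h)
    · intro h
      apply Subtype.ext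
      change MVChain.value (π x) = 0
      rw [(hzero x).2 h, MVChain.value_zero]
  have hf1 : ∀ b, IsIdem b → b ∉ A → f b = 1 := by
    intro b hb hbA
    apply Subtype.ext
    change MVChain.value (π b) = 1
    rw [htop b hb hbA, MVChain.value_top]
  have hfm : ∀ x y, π x ≤ π y → f x ≤ f y := fun x y h => MVChain.value_mono h
  have hfπ : ∀ x y, π x = π y → f x = f y := fun x y h =>
    Subtype.ext (congrArg MVChain.value h)
  refine ⟨⟨f, ⟨?_, ?_, ?_, (hf0 ⊥).2 hI.bot_mem, ?_⟩, e, hf1 e he heA⟩, Set.ext hf0⟩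
  · intro x y
    rcases le_total (π x) (π y) with h | h
    · rw [sup_eq_right.2 (hfm _ _ h), hfπ _ _ (hsup x y h)]
    · rw [sup_eq_left.2 (hfm _ _ h), sup_comm, hfπ _ _ (hsup y x h)]
  · intro x y
    rcases le_total (π x) (π y) with h | h
    · rw [inf_eq_left.2 (hfm _ _ h), hfπ _ _ (hinf x y h)]
    · rw [inf_eq_right.2 (hfm _ _ h), inf_comm, hfπ _ _ (hinf y x h)]
  · intro x y
    exact Subtype.ext (MVChain.value_add (π x) (π y))
  · intro b x hb hx
    by_cases hbA : b ∈ A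
    · have hxA := hI.lower _ _ hx hbA
      have hlA := hI.lower _ _ (lam_le_self hb hx) hbA
      rw [(hf0 _).2 hbA, (hf0 _).2 hxA, (hf0 _).2 hlA]
      exact (le_bot_iff.1 (lam_le_self (a := (0 : unitInterval)) (oplus_bot _) le_rfl)).symm
    · rw [hf1 b hb hbA, unit_lam unit_isIdem_one (f x).2.2]
      apply Subtype.ext
      rw [coe_unitDiff]
      change MVChain.value (π (lam b x)) = max (1 - MVChain.value (π x)) 0
      rw [hlam b x hb hbA hx, MVChain.value_neg,
        max_eq_left (sub_nonneg.2 (MVChain.value_le_one _))]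

namespace StateMorphism

variable (s t : StateMorphism M)

theorem coe_oplus (x y : M) : (s.1 (x ⊕ₑ y) : ℝ) = min ((s.1 x : ℝ) + s.1 y) 1 := by
  rw [s.2.1.map_oplus]
  rfl

theorem coe_lam {b x : M} (hb : IsIdem b) (hx : x ≤ b) :
    (s.1 (lam b x) : ℝ) = s.1 b - s.1 x := by
  have h : s.1 x ≤ s.1 b := s.2.1.mono hx
  rw [s.2.1.map_lam b x hb hx, unit_lam (s.2.1.isIdem hb) h, coe_unitDiff]
  exact max_eq_left (sub_nonneg.2 (Subtype.coe_le_coe.2 h))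

theorem eq_one_of_isIdem {b : M} (hb : IsIdem b) (h : b ∉ s.ker) : s.1 b = 1 :=
  (unit_isIdem (s.2.1.isIdem hb)).resolve_left h

theorem eq_one_of_le {x b : M} (hx : s.1 x = 1) (h : x ≤ b) : s.1 b = 1 :=
  le_antisymm (s.1 b).2.2 (hx.symm.le.trans (s.2.1.mono h))

theorem exists_isIdem (x : M) : ∃ b : M, IsIdem b ∧ x ≤ b ∧ s.1 b = 1 := by
  obtain ⟨u, hu⟩ := s.2.2
  obtain ⟨b, hb, hx, hub⟩ := exists_isIdem_le x u
  exact ⟨b, hb, hx, s.eq_one_of_le hu hub⟩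

theorem isIdeal_ker : IsIdeal s.ker where
  nonempty := ⟨⊥, s.2.1.map_bot⟩
  lower x y hxy hy := le_bot_iff.1 ((s.2.1.mono hxy).trans_eq hy)
  oplus_mem x y hx hy := by
    change s.1 (x ⊕ₑ y) = 0
    rw [s.2.1.map_oplus, hx, hy]
    exact oplus_bot _

/-- The witness is a multiple `x ⊕ ⋯ ⊕ x`: positivity of `s x` makes it reach 1, and it stays in
every ideal containing `x`. -/
theorem exists_eq_one {x : M} (hx : x ∉ s.ker) :
    ∃ z : M, s.1 z = 1 ∧ ∀ I : Set M, IsIdeal I → x ∈ I → z ∈ I := by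
  have h0 : 0 < (s.1 x : ℝ) :=
    lt_of_le_of_ne (s.1 x).2.1 fun h => hx (Subtype.ext h.symm)
  have key : ∀ n : ℕ, ∃ z : M, (s.1 z : ℝ) = min (n * (s.1 x : ℝ)) 1 ∧
      ∀ I : Set M, IsIdeal I → x ∈ I → z ∈ I := by
    intro n
    induction n with
    | zero =>
      refine ⟨⊥, ?_, fun I hI _ => hI.bot_mem⟩
      rw [s.2.1.map_bot, unit_bot]
      simp
    | succ n ih =>
      obtain ⟨z, hz, hzI⟩ := ih
      refine ⟨z ⊕ₑ x, ?_, fun I hI hx => hI.oplus_mem _ _ (hzI I hI hx) hx⟩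
      rw [s.coe_oplus, hz]
      push_cast
      grind
  obtain ⟨n, hn⟩ := exists_nat_gt (1 / (s.1 x : ℝ))
  obtain ⟨z, hz, hzI⟩ := key n
  refine ⟨z, Subtype.ext ?_, hzI⟩
  rw [hz, min_eq_right ((div_lt_iff₀ h0).1 hn).le]
  rfl

theorem isMaximalIdeal_ker : IsMaximalIdeal s.ker where
  isIdeal := s.isIdeal_ker
  ne_univ h := by
    obtain ⟨x, hx⟩ := s.2.2
    have : x ∈ s.ker := h ▸ Set.mem_univ x
    exact one_ne_zero (hx.symm.trans this)
  maximal J hJ hJu hsJ := by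
    refine (Set.Subset.antisymm hsJ fun x hx => ?_).symm
    by_contra hxs
    obtain ⟨z, hz, hzJ⟩ := s.exists_eq_one hxs
    refine hJu (Set.eq_univ_of_forall fun y => ?_)
    obtain ⟨b, hb, hy, hzb⟩ := exists_isIdem_le y z
    have hl : lam b z ∈ s.ker := by
      apply Subtype.ext
      rw [s.coe_lam hb hzb, hz, s.eq_one_of_le hz hzb]
      exact sub_self _
    refine hJ.lower _ _ hy ?_
    rw [← lam_oplus hb hzb]
    exact hJ.oplus_mem _ _ (hsJ hl) (hzJ J hJ hx)

variable {s t} in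
-- A kernel inclusion forces a pointwise inequality, by halving the error. The only use of the
-- inclusion is at the digit: if `t x ≤ 1/2`, the truncated `2x - 1` lies in `t.ker`, hence in
-- `s.ker`, so `s x ≤ 1/2`.
theorem le_of_ker_subset (h : t.ker ⊆ s.ker) (x : M) : (s.1 x : ℝ) ≤ t.1 x := by
  refine MVChain.le_of_forall_half_pow fun n => ?_
  induction n generalizing x with
  | zero =>
    rw [pow_zero]
    linarith [(s.1 x).2.2, (t.1 x).2.1]
  | succ n ih =>
    obtain ⟨b, hb, hx, htb⟩ := t.exists_isIdem x
    -- Both states take the value 1 at `c`, so `lam c` acts as `1 - ·` under both.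
    obtain ⟨c, hc, hbc, hsc⟩ := s.exists_isIdem b
    have hxc := hx.trans hbc
    have htc := t.eq_one_of_le htb hbc
    have hlx := lam_le_self hc hxc
    have key : ∀ r : StateMorphism M, r.1 c = 1 →
        (r.1 (lam c (lam c x ⊕ₑ lam c x)) : ℝ) = max (2 * (r.1 x : ℝ) - 1) 0 := by
      intro r hr
      rw [r.coe_lam hc (hc.oplus_le hlx hlx), r.coe_oplus, r.coe_lam hc hxc, hr]
      change (1 : ℝ) - min (1 - (r.1 x : ℝ) + (1 - (r.1 x : ℝ))) 1 = _
      grind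
    have h1 := ih (x ⊕ₑ x)
    have h2 := ih (lam c (lam c x ⊕ₑ lam c x))
    rw [s.coe_oplus, t.coe_oplus] at h1
    rw [key s hsc, key t htc] at h2
    rw [pow_succ]
    by_cases hk : (t.1 x : ℝ) ≤ 1 / 2
    · have : lam c (lam c x ⊕ₑ lam c x) ∈ t.ker := by
        apply Subtype.ext
        rw [key t htc]
        exact max_eq_right (by linarith)
      have h3 : (s.1 (lam c (lam c x ⊕ₑ lam c x)) : ℝ) = 0 := congrArg Subtype.val (h this)
      rw [key s hsc] at h3
      grind
    · have : (0 : ℝ) < (1 / 2) ^ n := by positivity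
      grind

variable {s t} in
theorem ker_injective (h : s.ker = t.ker) : s = t := by
  apply Subtype.ext
  funext x
  exact Subtype.ext (le_antisymm (le_of_ker_subset h.symm.subset x)
    (le_of_ker_subset h.subset x))

/-- The maximal ideal `Ker(s)`. -/
def toMaxI : MaxI M := ⟨s.ker, s.isMaximalIdeal_ker⟩

theorem toMaxI_bijective : Function.Bijective (toMaxI (M := M)) :=
  ⟨fun _ _ h => ker_injective (congrArg Subtype.val h), fun A =>
    let ⟨s, hs⟩ := A.2.exists_stateMorphism
    ⟨s, Subtype.ext hs⟩⟩

/-! ### Comparison of the weak and hull-kernel topologies -/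

theorem continuous_eval (x : M) : Continuous fun s : StateMorphism M => s.1 x :=
  (continuous_apply x).comp
    (continuous_subtype_val (p := fun s : M → unitInterval => IsEMVHom s ∧ ∃ x : M, s x = 1))

theorem continuous_toMaxI : Continuous (toMaxI (M := M)) := by
  refine continuous_def.2 ?_
  rintro _ ⟨I, -, rfl⟩
  have : toMaxI ⁻¹' hullCompl I = ⋃ x ∈ I, {s : StateMorphism M | s.1 x ≠ 0} := by
    ext s
    simp only [Set.mem_preimage, hullCompl, Set.mem_ofPred_eq, Set.not_subset, Set.mem_iUnion,
      exists_prop]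
    rfl
  rw [this]
  exact isOpen_biUnion fun x _ => isOpen_ne_fun (continuous_eval x) continuous_const

end StateMorphism

theorem isOpen_setOf_notMem (y : M) : IsOpen {A : MaxI M | y ∉ A.1} := by
  refine ⟨⋂₀ {I | IsIdeal I ∧ y ∈ I}, isIdeal_sInter fun I hI => hI.1, ?_⟩
  ext A
  refine not_congr ⟨fun h => Set.sInter_subset_of_mem ⟨A.2.isIdeal, h⟩, fun h => h ?_⟩
  exact fun I hI => hI.2

instance : T2Space (MaxI M) := by
  refine ⟨fun A B hAB => ?_⟩
  obtain ⟨s, rfl⟩ := StateMorphism.toMaxI_bijective.2 A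
  obtain ⟨t, rfl⟩ := StateMorphism.toMaxI_bijective.2 B
  have hn : ¬ s.ker ⊆ t.ker := fun h => hAB (Subtype.ext
    (s.isMaximalIdeal_ker.maximal _ t.isIdeal_ker t.isMaximalIdeal_ker.ne_univ h).symm)
  obtain ⟨y, hys, hyt⟩ := Set.not_subset.1 hn
  obtain ⟨z, hz, hzI⟩ := t.exists_eq_one hyt
  have hzs : s.1 z = 0 := hzI _ s.isIdeal_ker hys
  obtain ⟨b, hb, hzb, hsb⟩ := s.exists_isIdem z
  have htb := t.eq_one_of_le hz hzb
  have hl := lam_le_self hb hzb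
  have hdisj := lam_inf_lam hb hzb hl
  rw [lam_lam hb hzb] at hdisj
  -- These are the truncated `1 - 2z`, with value 1 at `s`, and `2z - 1`, with value 1 at `t`. Their
  -- meet is `⊥` by prelinearity for `z` and `lam b z`, so a prime ideal contains one of them.
  refine ⟨_, _, isOpen_setOf_notMem (lam b (z ⊕ₑ z)),
    isOpen_setOf_notMem (lam b (lam b z ⊕ₑ lam b z)), ?_, ?_, ?_⟩
  · intro h
    have h' : (s.1 (lam b (z ⊕ₑ z)) : ℝ) = 0 := congrArg Subtype.val h
    rw [s.coe_lam hb (hb.oplus_le hzb hzb), s.coe_oplus, hsb, hzs] at h'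
    norm_num at h'
  · intro h
    have h' : (t.1 (lam b (lam b z ⊕ₑ lam b z)) : ℝ) = 0 := congrArg Subtype.val h
    rw [t.coe_lam hb (hb.oplus_le hl hl), t.coe_oplus, t.coe_lam hb hzb, htb, hz] at h'
    norm_num at h'
  · refine Set.disjoint_left.2 fun C h1 h2 => ?_
    exact (C.2.prime (hdisj ▸ C.2.isIdeal.bot_mem)).elim h2 h1

/-- The chosen `lam` on `[0,1]` is replaced by the continuous `unitDiff`, so that every defining
condition is closed. -/
theorem isEMVHom_iff {f : M → unitInterval} : IsEMVHom f ↔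
    (∀ x y, f (x ⊔ y) = f x ⊔ f y) ∧ (∀ x y, f (x ⊓ y) = f x ⊓ f y) ∧
    (∀ x y, f (x ⊕ₑ y) = unitOplus (f x) (f y)) ∧ f ⊥ = 0 ∧
    ∀ b x, IsIdem b → x ≤ b → f (lam b x) = unitDiff (f b) (f x) := by
  constructor
  · intro h
    refine ⟨h.map_sup, h.map_inf, h.map_oplus, h.map_bot, fun b x hb hx => ?_⟩
    rw [h.map_lam b x hb hx, unit_lam (h.isIdem hb) (h.mono hx)]
  · rintro ⟨h1, h2, h3, h4, h5⟩
    refine ⟨h1, h2, h3, h4, fun b x hb hx => ?_⟩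
    have hb' : IsIdem (f b) := (h3 b b).symm.trans (congrArg f hb)
    have hx' : f x ≤ f b := by rw [← inf_eq_left, ← h2, inf_eq_left.2 hx]
    rw [h5 b x hb hx, unit_lam hb' hx']

theorem isClosed_isEMVHom : IsClosed {f : M → unitInterval | IsEMVHom f} := by
  have hadd : ∀ x y : M, Continuous fun f : M → unitInterval => unitOplus (f x) (f y) :=
    fun x y => Continuous.subtype_mk (by fun_prop) _
  have hsub : ∀ x y : M, Continuous fun f : M → unitInterval => unitDiff (f x) (f y) :=
    fun x y => Continuous.subtype_mk (by fun_prop) _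
  simp only [isEMVHom_iff, Set.ofPred_and, Set.ofPred_forall]
  refine IsClosed.inter ?_ (IsClosed.inter ?_ (IsClosed.inter ?_ (IsClosed.inter ?_ ?_)))
  · exact isClosed_iInter fun x => isClosed_iInter fun y => isClosed_eq (by fun_prop)
      ((continuous_apply x).sup (continuous_apply y))
  · exact isClosed_iInter fun x => isClosed_iInter fun y => isClosed_eq (by fun_prop)
      ((continuous_apply x).inf (continuous_apply y))
  · exact isClosed_iInter fun x => isClosed_iInter fun y => isClosed_eq (by fun_prop)
      (hadd x y)
  · exact isClosed_eq (by fun_prop) continuous_const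
  · exact isClosed_iInter fun b => isClosed_iInter fun x => isClosed_iInter fun _ =>
      isClosed_iInter fun _ => isClosed_eq (by fun_prop)
        (hsub b x)

/-- Attaining 1 somewhere is not a closed condition, but attaining it at the fixed `b` is, and it
implies the former. -/
theorem isCompact_setOf_eq_one (b : M) : IsCompact {s : StateMorphism M | s.1 b = 1} := by
  have hind : Topology.IsInducing (fun s : StateMorphism M => s.1) :=
    Topology.IsInducing.subtypeVal (t := {s : M → unitInterval | IsEMVHom s ∧ ∃ x : M, s x = 1})
  rw [hind.isCompact_iff]
  have : (fun s : StateMorphism M => s.1) '' {s | s.1 b = 1} =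
      {f : M → unitInterval | IsEMVHom f} ∩ {f | f b = 1} := by
    ext f
    constructor
    · rintro ⟨s, hs, rfl⟩
      exact ⟨s.2.1, hs⟩
    · rintro ⟨h1, h2⟩
      exact ⟨⟨f, h1, b, h2⟩, h2, rfl⟩
  rw [this]
  exact (isClosed_isEMVHom.inter (isClosed_eq (continuous_apply b) continuous_const)).isCompact

namespace StateMorphism

theorem isOpenMap_toMaxI : IsOpenMap (toMaxI (M := M)) := by
  intro U hU
  rw [isOpen_iff_forall_mem_open]
  rintro _ ⟨s, hs, rfl⟩
  obtain ⟨b, hb, -, hsb⟩ := s.exists_isIdem ⊥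
  have hcl : IsClosed (toMaxI '' ({t : StateMorphism M | t.1 b = 1} ∩ Uᶜ)) :=
    (((isCompact_setOf_eq_one b).inter_right hU.isClosed_compl).image
      continuous_toMaxI).isClosed
  -- States take only the values 0 and 1 at `b`, so `b ∉ A` corresponds to `t b = 1`. Removing the
  -- closed image of the part outside `U` leaves a neighbourhood inside the image of `U`.
  refine ⟨{A | b ∉ A.1} ∩ (toMaxI '' ({t : StateMorphism M | t.1 b = 1} ∩ Uᶜ))ᶜ, ?_,
    (isOpen_setOf_notMem b).inter hcl.isOpen_compl, ?_, ?_⟩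
  · rintro A ⟨hbA, hA⟩
    obtain ⟨t, rfl⟩ := toMaxI_bijective.2 A
    by_contra hn
    exact hA ⟨t, ⟨t.eq_one_of_isIdem hb hbA, fun h => hn ⟨t, h, rfl⟩⟩, rfl⟩
  · exact fun h => one_ne_zero (hsb.symm.trans h)
  · rintro ⟨t, ⟨-, ht⟩, e⟩
    exact ht (toMaxI_bijective.1 e ▸ hs)

theorem isHomeomorph_toMaxI : IsHomeomorph (toMaxI (M := M)) :=
  ⟨continuous_toMaxI, isOpenMap_toMaxI, toMaxI_bijective⟩

/-! ### Compactness and top elements -/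

theorem compactSpace_of_isTop {t : M} (ht : IsTop t) : CompactSpace (StateMorphism M) := by
  refine ⟨?_⟩
  have : (Set.univ : Set (StateMorphism M)) = {s | s.1 t = 1} := by
    refine (Set.eq_univ_of_forall fun s => ?_).symm
    obtain ⟨x, hx⟩ := s.2.2
    exact s.eq_one_of_le hx (ht x)
  rw [this]
  exact isCompact_setOf_eq_one t

end StateMorphism

/-- An ideal that omits an idempotent `c` extends to a maximal ideal that omits `c`. -/
theorem IsIdeal.exists_isMaximalIdeal {I : Set M} (hI : IsIdeal I) {c : M} (hc : IsIdem c)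
    (hcI : c ∉ I) : ∃ A : Set M, IsMaximalIdeal A ∧ I ⊆ A ∧ c ∉ A := by
  obtain ⟨A, hIA, hA⟩ := zorn_subset_nonempty {J : Set M | IsIdeal J ∧ c ∉ J} (by
    intro S hS hchain hne
    refine ⟨⋃₀ S, ⟨⟨?_, ?_, ?_⟩, ?_⟩, fun J hJ => Set.subset_sUnion_of_mem hJ⟩
    · obtain ⟨J, hJ⟩ := hne
      exact ⟨⊥, J, hJ, (hS hJ).1.bot_mem⟩
    · rintro x y hxy ⟨J, hJ, hy⟩
      exact ⟨J, hJ, (hS hJ).1.lower _ _ hxy hy⟩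
    · rintro x y ⟨J, hJ, hx⟩ ⟨K, hK, hy⟩
      rcases hchain.total hJ hK with h | h
      · exact ⟨K, hK, (hS hK).1.oplus_mem _ _ (h hx) hy⟩
      · exact ⟨J, hJ, (hS hJ).1.oplus_mem _ _ hx (h hy)⟩
    · rintro ⟨J, hJ, hcJ⟩
      exact (hS hJ).2 hcJ) I ⟨hI, hcI⟩
  obtain ⟨⟨hAI, hcA⟩, hmax⟩ := hA
  refine ⟨A, ⟨hAI, fun h => hcA (h ▸ Set.mem_univ c), fun J hJ hJu hAJ => ?_⟩, hIA, hcA⟩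
  refine (Set.Subset.antisymm hAJ (hmax ⟨hJ, fun hcJ => hJu ?_⟩ hAJ)).symm
  refine Set.eq_univ_of_forall fun y => ?_
  obtain ⟨b, hb, hy, hcb⟩ := exists_isIdem_le y c
  -- `K` is an ideal that contains `A` and omits `c`, so it equals `A`. Complements of `c` thus lie
  -- in `A`, and an ideal containing both `A` and `c` contains every idempotent above `c`.
  let K : Set M := {z | c ⊓ z ∈ A}
  have hK : IsIdeal K :=
    { nonempty := ⟨⊥, hAI.lower _ _ inf_le_right hAI.bot_mem⟩
      lower := fun z w hzw hw => hAI.lower _ _ (inf_le_inf_left c hzw) hw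
      oplus_mem := fun z w hz hw =>
        hAI.lower _ _ (inf_oplus_le c z w) (hAI.oplus_mem _ _ hz hw) }
  have hKA : K ⊆ A := hmax ⟨hK, fun h => hcA (by simpa [K] using h)⟩
    fun z hz => hAI.lower _ _ inf_le_right hz
  have hl : lam b c ∈ A := hKA (by
    change c ⊓ lam b c ∈ A
    rw [inf_lam_idem hb hc hcb]
    exact hAI.bot_mem)
  refine hJ.lower _ _ hy ?_
  rw [← lam_oplus hb hcb]
  exact hJ.oplus_mem _ _ (hAJ hl) hcJ

theorem isIdeal_Iic {a : M} (ha : IsIdem a) : IsIdeal (Set.Iic a) where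
  nonempty := ⟨a, le_refl a⟩
  lower _ _ h h' := le_trans h h'
  oplus_mem _ _ h h' := ha.oplus_le h h'

theorem exists_isTop_of_compactSpace [CompactSpace (MaxI M)] : ∃ t : M, IsTop t := by
  have : Nonempty {a : M // IsIdem a} := ⟨⟨⊥, oplus_bot _⟩⟩
  -- The sets of maximal ideals omitting a given idempotent form a directed open cover, so one
  -- idempotent `a` avoids all maximal ideals.
  obtain ⟨⟨a, ha⟩, hcover⟩ := isCompact_univ.elim_directed_cover
    (fun a : {a : M // IsIdem a} => {A : MaxI M | a.1 ∉ A.1})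
    (fun a => isOpen_setOf_notMem a.1)
    (fun A _ => by
      obtain ⟨e, he, heA⟩ := A.2.exists_isIdem
      exact Set.mem_iUnion.2 ⟨⟨e, he⟩, heA⟩)
    (fun a b => by
      obtain ⟨c, hc, hac, hbc⟩ := exists_isIdem_le a.1 b.1
      exact ⟨⟨c, hc⟩, fun A h h' => h (A.2.isIdeal.lower _ _ hac h'),
        fun A h h' => h (A.2.isIdeal.lower _ _ hbc h')⟩)
  refine ⟨a, fun x => ?_⟩
  obtain ⟨b, hb, hxb⟩ := exists_idempotent x
  by_contra hx
  -- If `a` were not the top, the ideal `[⊥, a]` would omit some idempotent `b` and extend to a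
  -- maximal ideal containing `a`.
  obtain ⟨A, hA, haA, -⟩ := (isIdeal_Iic ha).exists_isMaximalIdeal hb
    (fun h => hx (hxb.trans h))
  exact hcover (Set.mem_univ ⟨A, hA⟩) (haA (le_refl a))

end States

end EMVAlgebra

theorem mainTheorem4 {M : Type*} [DistribLattice M] [OrderBot M] [EMVAlgebra M] :
    (∃ θ : EMVAlgebra.StateMorphism M ≃ₜ EMVAlgebra.MaxI M,
      ∀ s : EMVAlgebra.StateMorphism M, (θ s).1 = s.ker) ∧
    List.TFAE [
      ∃ t : M, IsTop t,
      CompactSpace (EMVAlgebra.StateMorphism M),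
      CompactSpace (EMVAlgebra.MaxI M)] := by
  have hθ := EMVAlgebra.StateMorphism.isHomeomorph_toMaxI (M := M)
  refine ⟨⟨hθ.homeomorph, fun _ => rfl⟩, ?_⟩
  tfae_have 1 → 2 := fun ⟨_, ht⟩ => EMVAlgebra.StateMorphism.compactSpace_of_isTop ht
  tfae_have 2 → 3 := fun _ => hθ.homeomorph.compactSpace
  tfae_have 3 → 1 := fun _ => EMVAlgebra.exists_isTop_of_compactSpace
  tfae_finish
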